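/- Modal formulas are built from countably many propositional variables, the Booleans and, in the unimodal case, one operator $\Box$, or, in the bimodal case, two operators $\Box_0,\Box_1$, with $\Diamond=\neg\Box\neg$ and $\Diamond_i=\neg\Box_i\neg$. They are evaluated as usual in Kripke models over non-empty frames $(W,R)$, respectively $(W,R_0,R_1)$. A (normal) logic is a set of formulas that contains all propositional tautologies and the formulas $\Box_i(p\to q)\to(\Box_i p\to\Box_i q)$ and is closed under substitution, modus ponens and necessitation $\varphi/\Box_i\varphi$ (for each box of the language). For a class $\mathcal C$ of frames, $\mathsf{Log}\,\mathcal C$ is the set of formulas valid in all members of $\mathcal C$, and $\mathsf{Fr}\,L$ is the class of all frames in which every formula of $L$ is valid. A logic $L$ has the finite model property (fmp) if every formula not in $L$ fails at some point of some finite model in which all formulas of $L$ are true at every point. For unimodal logics $L_0,L_1$, the first written with $\Box_0$ and the second with $\Box_1$, the fusion $L_0\oplus L_1$ is the smallest bimodal logic containing $L_0\cup L_1$; the commutator $[L_0,L_1]$ is the smallest bimodal logic containing $L_0\oplus L_1$ and the formulas $$\Box_1\Box_0 p\to\Box_0\Box_1 p,\qquad \Box_0\Box_1 p\to\Box_1\Box_0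 p,\qquad \Diamond_0\Box_1 p\to\Box_1\Diamond_0 p;$$ and the product is $L_0\times L_1=\mathsf{Log}\{\mathfrak F_0\times\mathfrak F_1:\mathfrak F_0\in\mathsf{Fr}\,L_0,\ \mathfrak F_1\in\mathsf{Fr}\,L_1\}$, where $(W_0,R_0)\times(W_1,R_1)=(W_0\times W_1,\overline R_0,\overline R_1)$ with $(u,v)\overline R_0(u',v')$ iff $uR_0u'$ and $v=v'$, and $(u,v)\overline R_1(u',v')$ iff $vR_1v'$ and $u=u'$. Let $\mathbf K$, $\mathbf{S5}$ and $\mathbf{Diff}$ be the unimodal logics determined, respectively, by all frames, by all frames $(W,R)$ with $R$ an equivalence relation, and by all difference frames $(W,\neq)$. Let $\mathbf{S4.3}$ be the unimodal logic determined by all frames $(W,R)$ with $R$ reflexive, transitive and weakly connected, the last meaning $\forall x,y,z\,(xRy\wedge xRz\to y=z\vee yRz\vee zRy)$. **Corollary.** Let $L_0$ be any of $\mathsf{Log}(\omega,<)$, $\mathsf{Log}(\omega,\le)$, $\mathbf{S4.3}$, $\mathsf{Log}(\mathbb Q,<)$, and let $L_1$ be any of $\mathbf K$, $\mathbf{S5}$,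 $\mathbf{Diff}$. Then no bimodal logic $L$ with $[L_0,L_1]\subseteq L\subseteq L_0\times L_1$ has the fmp. In particular, $\mathbf{S4.3}\times\mathbf{S5}$ does not have the fmp. -/

import Mathlib

namespace ModalLogic

/-- Propositional modal formulas with modalities indexed by `ι`. Propositional variables are
indexed by `ℕ`. Negation, conjunction, disjunction and diamonds are the usual abbreviations.
Unimodal formulas are `Formula Unit`, bimodal formulas are `Formula (Fin 2)`. -/
inductive Formula (ι : Type) : Type where
  | var : ℕ → Formula ι
  | bot : Formula ι
  | imp : Formula ι → Formula ι → Formula ι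
  | box : ι → Formula ι → Formula ι

namespace Formula

variable {ι κ : Type}

def neg (φ : Formula ι) : Formula ι := imp φ bot

def dia (i : ι) (φ : Formula ι) : Formula ι := neg (box i (neg φ))

/-- Simultaneous uniform substitution of formulas for propositional variables. -/
def subst (σ : ℕ → Formula ι) : Formula ι → Formula ι
  | var n => σ n
  | bot => bot
  | imp φ ψ => imp (subst σ φ) (subst σ ψ)
  | box i φ => box i (subst σ φ)

/-- Rename the modal operators along `f`. -/
def rename (f : ι → κ) : Formula ι → Formula κ
  | var n => var n
  | bot => bot
  | imp φ ψ => imp (rename f φ) (rename f ψ)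
  | box i φ => box (f i) (rename f φ)

/-- `φ` is true under every Boolean valuation, where variables and boxed formulas are treated as
atoms; that is, `φ` is a substitution instance of a propositional tautology. -/
def IsTautology (φ : Formula ι) : Prop :=
  ∀ v : Formula ι → Prop, ¬ v bot → (∀ α β, v (imp α β) ↔ (v α → v β)) → v φ

end Formula

open Formula

/-- Kripke frames with one binary relation for each `i : ι`, on a non-empty set. -/
structure Frame (ι : Type) : Type 1 where
  World : Type
  nonempty : Nonempty World
  rel : ι → World → World → Prop

/-- The truth relation in the model based on `F` with valuation `V`. -/
def Sat {ι : Type} (F : Frame ι) (V : ℕ → Set F.World) : F.World → Formula ι → Prop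
  | w, var n => w ∈ V n
  | _, bot => False
  | w, imp φ ψ => Sat F V w φ → Sat F V w ψ
  | w, box i φ => ∀ u, F.rel i w u → Sat F V u φ

def Valid {ι : Type} (F : Frame ι) (φ : Formula ι) : Prop :=
  ∀ (V : ℕ → Set F.World) (w : F.World), Sat F V w φ

/-- The class of all frames for a set of formulas. -/
def Fr {ι : Type} (S : Set (Formula ι)) : Set (Frame ι) := {F | ∀ φ ∈ S, Valid F φ}

/-- The logic determined by a class of frames. -/
def Log {ι : Type} (C : Set (Frame ι)) : Set (Formula ι) := {φ | ∀ F ∈ C, Valid F φ}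

/-- Normal modal logics. -/
structure IsNormalLogic {ι : Type} (L : Set (Formula ι)) : Prop where
  taut : ∀ φ, IsTautology φ → φ ∈ L
  distrib : ∀ i, imp (box i (imp (var 0) (var 1))) (imp (box i (var 0)) (box i (var 1))) ∈ L
  subst : ∀ (σ : ℕ → Formula ι) (φ), φ ∈ L → φ.subst σ ∈ L
  mp : ∀ φ ψ, imp φ ψ ∈ L → φ ∈ L → ψ ∈ L
  nec : ∀ i φ, φ ∈ L → box i φ ∈ L

/-- The smallest normal modal logic containing `S`. -/
def smallestLogic {ι : Type} (S : Set (Formula ι)) : Set (Formula ι) :=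
  {φ | ∀ L : Set (Formula ι), IsNormalLogic L → S ⊆ L → φ ∈ L}

/-- The finite model property: every formula outside `L` fails at some point of some finite model
in which every formula of `L` is true at every point. -/
def HasFMP {ι : Type} (L : Set (Formula ι)) : Prop :=
  ∀ φ, φ ∉ L → ∃ (F : Frame ι) (V : ℕ → Set F.World),
    Finite F.World ∧ (∀ ψ ∈ L, ∀ w, Sat F V w ψ) ∧ ∃ w, ¬ Sat F V w φ

/-- The fusion of two unimodal logics, the first one being written with the modality `0`, the second
one with the modality `1`. -/
def fusion (L₀ L₁ : Set (Formula Unit)) : Set (Formula (Fin 2)) :=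
  smallestLogic (rename (fun _ => 0) '' L₀ ∪ rename (fun _ => 1) '' L₁)

/-- The formulas for left commutativity, right commutativity and confluence. -/
def commAxioms : Set (Formula (Fin 2)) :=
  {imp (box 1 (box 0 (var 0))) (box 0 (box 1 (var 0))),
   imp (box 0 (box 1 (var 0))) (box 1 (box 0 (var 0))),
   imp (dia 0 (box 1 (var 0))) (box 1 (dia 0 (var 0)))}

/-- The commutator `[L₀, L₁]`. -/
def commutator (L₀ L₁ : Set (Formula Unit)) : Set (Formula (Fin 2)) :=
  smallestLogic (fusion L₀ L₁ ∪ commAxioms)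

/-- The product of two unimodal frames. -/
def prodFrame (F₀ F₁ : Frame Unit) : Frame (Fin 2) where
  World := F₀.World × F₁.World
  nonempty := ⟨(F₀.nonempty.some, F₁.nonempty.some)⟩
  rel i a b :=
    if i = 0 then F₀.rel () a.1 b.1 ∧ a.2 = b.2 else F₁.rel () a.2 b.2 ∧ a.1 = b.1

/-- The product logic `L₀ × L₁`. -/
def prodLogic (L₀ L₁ : Set (Formula Unit)) : Set (Formula (Fin 2)) :=
  Log {F | ∃ F₀ ∈ Fr L₀, ∃ F₁ ∈ Fr L₁, F = prodFrame F₀ F₁}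

/-- The unimodal frame `(W, R)`. -/
def uframe (W : Type) [h : Nonempty W] (R : W → W → Prop) : Frame Unit where
  World := W
  nonempty := h
  rel _ := R

def WeaklyConnected {W : Type} (R : W → W → Prop) : Prop :=
  ∀ x y z, R x y → R x z → (y = z ∨ R y z ∨ R z y)

/-- The logic of `(ω, <)`. -/
def LogOmegaLt : Set (Formula Unit) := Log {uframe ℕ (· < ·)}

/-- The logic of `(ω, ≤)`. -/
def LogOmegaLe : Set (Formula Unit) := Log {uframe ℕ (· ≤ ·)}

/-- The logic of `(ℚ, <)`. -/
def LogRatLt : Set (Formula Unit) := Log {uframe ℚ (· < ·)}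

/-- The logic of all reflexive, transitive and weakly connected frames. -/
def LogS43 : Set (Formula Unit) :=
  Log {F | (∀ x, F.rel () x x) ∧ (∀ x y z, F.rel () x y → F.rel () y z → F.rel () x z) ∧
    WeaklyConnected (F.rel ())}

/-- The logic of all frames. -/
def LogK : Set (Formula Unit) := Log Set.univ

/-- The logic of all equivalence frames. -/
def LogS5 : Set (Formula Unit) := Log {F | Equivalence (F.rel ())}

/-- The logic of all difference frames `(W, ≠)`. -/
def LogDiff : Set (Formula Unit) := Log {F | ∀ x y, F.rel () x y ↔ x ≠ y}

end ModalLogic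

/-! One formula, `formulaInfinity`, settles all cases. It is satisfiable in a product of a frame for
`L₀` and a frame for `L₁`, so its negation lies outside `L`. It also forces infinitely many points
in every frame of the commutator. Since a normal logic with the fmp is complete for its finite
frames (`HasFMP.exists_finite_frame`), `L` cannot have the fmp.

Infinity (`infinite_of_sat`): colour the columns with `var 0` and let the rank of a point be the
largest number of colour changes along a horizontal chain starting there. Commutativity and
confluence make rank constant along columns. From a point of rank `k` go up to an `s`-point in its
column (`s` is `var 1`). In the row of that `s`-point, linearity and the formula provide a point of
rank exactly `k + 1`, which right commutativity transports back to the root's row. So every finite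
rank occurs.

Satisfiability (`sat_formulaInfinity`): take the chain `⊤ > … > 2 > 1 > 0`, read downwards, times a
fan on `ℕ`. This chain is a frame for `L₀` even when `L₀` is given by `ω` or `ℚ`: modal formulas
cannot tell the infinite descent from long finite ones (`chainFrame_mem_Fr`). -/

namespace ModalLogic

open Formula

/-! ### Truth conditions and soundness. -/

section Basic

variable {ι : Type}

/-- Conjunction. -/
def Formula.conj (φ ψ : Formula ι) : Formula ι := neg (imp φ (neg ψ))

variable {F : Frame ι} {V : ℕ → Set F.World} {w : F.World}

@[simp] theorem sat_var {n : ℕ} : Sat F V w (var n) ↔ w ∈ V n := Iff.rfl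

@[simp] theorem sat_imp {φ ψ : Formula ι} :
    Sat F V w (imp φ ψ) ↔ (Sat F V w φ → Sat F V w ψ) := Iff.rfl

@[simp] theorem sat_box {i : ι} {φ : Formula ι} :
    Sat F V w (box i φ) ↔ ∀ u, F.rel i w u → Sat F V u φ := Iff.rfl

@[simp] theorem sat_neg {φ : Formula ι} : Sat F V w (neg φ) ↔ ¬ Sat F V w φ := Iff.rfl

@[simp] theorem sat_dia {i : ι} {φ : Formula ι} :
    Sat F V w (dia i φ) ↔ ∃ u, F.rel i w u ∧ Sat F V u φ := by
  simp [dia]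

@[simp] theorem sat_conj {φ ψ : Formula ι} :
    Sat F V w (conj φ ψ) ↔ Sat F V w φ ∧ Sat F V w ψ := by
  simp [conj]

theorem sat_subst (σ : ℕ → Formula ι) (φ : Formula ι) :
    Sat F V w (φ.subst σ) ↔ Sat F (fun n => {u | Sat F V u (σ n)}) w φ := by
  induction φ generalizing w with
  | var n => rfl
  | bot => rfl
  | imp φ ψ ihφ ihψ => exact imp_congr ihφ ihψ
  | box i φ ih => exact forall_congr' fun u => imp_congr Iff.rfl ih

theorem isNormalLogic_Log (C : Set (Frame ι)) : IsNormalLogic (Log C) where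
  taut _ hφ F _ V w := hφ (Sat F V w) (fun h => h) (fun _ _ => Iff.rfl)
  distrib _ _ _ _ _ h₁ h₂ u hu := h₁ u hu (h₂ u hu)
  subst σ φ hφ F hF _ w := (sat_subst σ φ).2 (hφ F hF _ w)
  mp _ _ h₁ h₂ F hF V w := h₁ F hF V w (h₂ F hF V w)
  nec _ _ h F hF V _ u _ := h F hF V u

theorem mem_Fr_Log {C : Set (Frame ι)} (h : F ∈ C) : F ∈ Fr (Log C) :=
  fun _ hφ => hφ F h

theorem subset_smallestLogic (S : Set (Formula ι)) : S ⊆ smallestLogic S :=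
  fun _ hφ _ _ hS => hS hφ

end Basic

/-! ### From finite models to finite frames. -/

section FiniteFrames

variable {ι : Type} (F : Frame ι) (V : ℕ → Set F.World)

/-- The set of formulas true at a point of a model. -/
def pointTheory (w : F.World) : Set (Formula ι) := {φ | Sat F V w φ}

/-- The frame formed by the theories of the points of a model. -/
def theoryFrame : Frame ι where
  World := Set.range (pointTheory F V)
  nonempty := ⟨⟨_, F.nonempty.some, rfl⟩⟩
  rel i S T := ∀ φ, box i φ ∈ S.1 → φ ∈ T.1

variable {F V}

theorem neg_mem_theory (T : (theoryFrame F V).World) (φ : Formula ι) :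
    neg φ ∈ T.1 ↔ φ ∉ T.1 := by
  obtain ⟨_, w, rfl⟩ := T
  exact Iff.rfl

theorem imp_mem_theory (T : (theoryFrame F V).World) (φ ψ : Formula ι) :
    imp φ ψ ∈ T.1 ↔ (φ ∈ T.1 → ψ ∈ T.1) := by
  obtain ⟨_, w, rfl⟩ := T
  exact Iff.rfl

theorem box_mem_theory (T : (theoryFrame F V).World) (i : ι) (φ : Formula ι) :
    box i φ ∈ T.1 ↔ ∀ S, (theoryFrame F V).rel i T S → φ ∈ S.1 := by
  refine ⟨fun h S hS => hS φ h, fun h => ?_⟩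
  obtain ⟨_, w, rfl⟩ := T
  exact fun u hu => h ⟨_, u, rfl⟩ fun ψ hψ => hψ u hu

theorem sat_theoryFrame {U : ℕ → Set (theoryFrame F V).World} {σ : ℕ → Formula ι}
    (hσ : ∀ n T, σ n ∈ T.1 ↔ T ∈ U n) (T : (theoryFrame F V).World) (φ : Formula ι) :
    Sat (theoryFrame F V) U T φ ↔ φ.subst σ ∈ T.1 := by
  induction φ generalizing T with
  | var n => exact (hσ n T).symm
  | bot =>
    obtain ⟨_, w, rfl⟩ := T
    exact Iff.rfl
  | imp φ ψ ihφ ihψ => exact (imp_congr (ihφ T) (ihψ T)).trans (imp_mem_theory T _ _).symm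
  | box i φ ih =>
    exact (forall_congr' fun S => imp_congr Iff.rfl (ih S)).trans (box_mem_theory T i _).symm

/-- Theories of points are complete, so one inclusion between two of them already forces equality.
-/
theorem exists_separating {S T : (theoryFrame F V).World} (h : S ≠ T) :
    ∃ φ, φ ∈ S.1 ∧ φ ∉ T.1 := by
  by_contra! hc
  refine h (Subtype.ext (Set.Subset.antisymm hc fun φ hφ => ?_))
  by_contra hS
  exact (neg_mem_theory T φ).1 (hc _ ((neg_mem_theory S φ).2 hS)) hφ

theorem exists_separating_finset (T : (theoryFrame F V).World)
    (s : Finset (theoryFrame F V).World) :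
    ∃ φ, φ ∈ T.1 ∧ ∀ S ∈ s, S ≠ T → φ ∉ S.1 := by
  classical
  induction s using Finset.induction_on with
  | empty => exact ⟨imp bot bot, (imp_mem_theory T _ _).2 id, by simp⟩
  | insert S s _ ih =>
    obtain ⟨φ, hφ, hs⟩ := ih
    by_cases h : T = S
    · refine ⟨φ, hφ, fun S' hS' hne => ?_⟩
      rcases Finset.mem_insert.1 hS' with rfl | hS'
      · exact absurd h.symm hne
      · exact hs S' hS' hne
    · obtain ⟨ψ, hψ, hψS⟩ := exists_separating h
      refine ⟨conj φ ψ, ?_, fun S' hS' hne => ?_⟩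
      · simp only [conj, neg_mem_theory, imp_mem_theory]
        tauto
      · simp only [conj, neg_mem_theory, imp_mem_theory]
        rcases Finset.mem_insert.1 hS' with rfl | hS'
        · tauto
        · have := hs S' hS' hne
          tauto

theorem exists_defining [Finite (theoryFrame F V).World] (U : Set (theoryFrame F V).World) :
    ∃ φ : Formula ι, ∀ T, φ ∈ T.1 ↔ T ∈ U := by
  classical
  have := Fintype.ofFinite (theoryFrame F V).World
  choose χ hχ hχ' using fun T : (theoryFrame F V).World =>
    exists_separating_finset T Finset.univ
  suffices h : ∀ s : Finset (theoryFrame F V).World, ∃ φ : Formula ι, ∀ T, φ ∈ T.1 ↔ T ∈ s by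
    obtain ⟨φ, hφ⟩ := h U.toFinset
    exact ⟨φ, fun T => (hφ T).trans (by simp)⟩
  intro s
  induction s using Finset.induction_on with
  | empty =>
    refine ⟨bot, fun T => iff_of_false ?_ (Finset.notMem_empty T)⟩
    obtain ⟨_, w, rfl⟩ := T
    exact id
  | insert S s _ ih =>
    obtain ⟨φ, hφ⟩ := ih
    -- This is the disjunction of `χ S` and `φ`.
    refine ⟨imp (neg (χ S)) φ, fun T => ?_⟩
    rw [imp_mem_theory, neg_mem_theory, hφ, Finset.mem_insert]
    by_cases h : T = S
    · subst h
      simp [hχ]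
    · simp [h, hχ' S T (Finset.mem_univ _) h]

/-- In the finite quotient by theories every set of points is definable. A valuation there is
therefore a substitution, and closure of `L` under substitution upgrades truth in the model to
validity in the frame. -/
theorem HasFMP.exists_finite_frame {L : Set (Formula ι)} (hL : IsNormalLogic L) (h : HasFMP L)
    {φ : Formula ι} (hφ : φ ∉ L) : ∃ G ∈ Fr L, Finite G.World ∧ ¬ Valid G φ := by
  obtain ⟨F, V, hfin, hV, w, hw⟩ := h φ hφ
  have : Finite (theoryFrame F V).World := Set.finite_range (pointTheory F V)
  refine ⟨theoryFrame F V, fun ψ hψ U T => ?_, this, fun hval => hw ?_⟩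
  · choose σ hσ using fun n => exists_defining (U n)
    rw [sat_theoryFrame hσ]
    obtain ⟨_, u, rfl⟩ := T
    exact hV _ (hL.subst σ ψ hψ) u
  · have h₁ := (sat_theoryFrame (F := F) (V := V)
      (U := fun n => {T | var n ∈ T.1}) (σ := var) (fun _ _ => Iff.rfl) ⟨_, w, rfl⟩ φ).1 (hval _ _)
    have h₂ := (sat_subst (F := F) (V := V) (w := w) var φ).1 h₁
    exact h₂

end FiniteFrames

/-! ### First-order frame conditions of the commutator. -/

section Correspondence

/-- The transitivity axiom. -/
def axiomTrans : Formula Unit := imp (box () (var 0)) (box () (box () (var 0)))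

/-- The weak connectedness axiom. -/
def axiomWeaklyConnected : Formula Unit :=
  imp (neg (box () (imp (var 0) (imp (box () (var 0)) (var 1)))))
    (box () (imp (var 1) (imp (box () (var 1)) (var 0))))

/-- These two formulas are all that the infinity argument needs from `L₀`. -/
theorem axioms_mem_Log {C : Set (Frame Unit)}
    (h : ∀ F ∈ C, (∀ x y z, F.rel () x y → F.rel () y z → F.rel () x z) ∧
      WeaklyConnected (F.rel ())) :
    axiomTrans ∈ Log C ∧ axiomWeaklyConnected ∈ Log C := by
  refine ⟨fun F hF V w h₁ u hu v hv => h₁ v ((h F hF).1 _ _ _ hu hv), fun F hF V w h₁ z hz hq hq' => ?_⟩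
  simp only [sat_neg, sat_box, sat_imp, not_forall] at h₁
  obtain ⟨y, hy, hp, hp', hn⟩ := h₁
  rcases (h F hF).2 w y z hy hz with rfl | h' | h'
  · exact hp
  · exact hp' z h'
  · exact absurd (hq' y h') hn

variable {F : Frame (Fin 2)}

theorem trans_of_valid (h : Valid F (rename (fun _ => 0) axiomTrans)) {x y z : F.World}
    (hxy : F.rel 0 x y) (hyz : F.rel 0 y z) : F.rel 0 x z :=
  h (fun _ => {u | F.rel 0 x u}) x (fun _ hu => hu) y hxy z hyz

theorem weaklyConnected_of_valid (h : Valid F (rename (fun _ => 0) axiomWeaklyConnected)) :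
    WeaklyConnected (F.rel 0) := by
  intro x y z hy hz
  by_contra! hc
  -- Minimal valuations: `var 0` holds at `y` and its successors, `var 1` at `z` and its successors.
  have := h (fun n => if n = 0 then {u | u = y ∨ F.rel 0 y u} else {u | u = z ∨ F.rel 0 z u}) x
    (fun h₁ => by
      rcases h₁ y hy (Or.inl rfl) (fun u hu => Or.inr hu) with h₂ | h₂
      · exact hc.1 h₂
      · exact hc.2.2 h₂) z hz (Or.inl rfl) (fun u hu => Or.inr hu)
  rcases this with h₂ | h₂
  · exact hc.1 h₂.symm
  · exact hc.2.1 h₂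

theorem leftComm_of_valid
    (h : Valid F (imp (box 1 (box 0 (var 0))) (box 0 (box 1 (var 0))))) {x y z : F.World}
    (hxy : F.rel 0 x y) (hyz : F.rel 1 y z) : ∃ u, F.rel 1 x u ∧ F.rel 0 u z :=
  h (fun _ => {v | ∃ u, F.rel 1 x u ∧ F.rel 0 u v}) x (fun u hu _ hv => ⟨u, hu, hv⟩) y hxy z hyz

theorem rightComm_of_valid
    (h : Valid F (imp (box 0 (box 1 (var 0))) (box 1 (box 0 (var 0))))) {x y z : F.World}
    (hxy : F.rel 1 x y) (hyz : F.rel 0 y z) : ∃ u, F.rel 0 x u ∧ F.rel 1 u z :=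
  h (fun _ => {v | ∃ u, F.rel 0 x u ∧ F.rel 1 u v}) x (fun u hu _ hv => ⟨u, hu, hv⟩) y hxy z hyz

theorem confluent_of_valid
    (h : Valid F (imp (dia 0 (box 1 (var 0))) (box 1 (dia 0 (var 0))))) {x y z : F.World}
    (hxy : F.rel 0 x y) (hxz : F.rel 1 x z) : ∃ u, F.rel 1 y u ∧ F.rel 0 z u := by
  have h₁ := h (fun _ => {u | F.rel 1 y u}) x
  simp only [sat_imp, sat_dia, sat_box, sat_var, Set.mem_ofPred_eq] at h₁
  obtain ⟨u, hzu, hyu⟩ := h₁ ⟨y, hxy, fun _ hu => hu⟩ z hxz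
  exact ⟨u, hyu, hzu⟩

/-- The frame conditions of a commutator whose first component is transitive and weakly
connected. -/
structure IsLinearCommFrame (F : Frame (Fin 2)) : Prop where
  trans : ∀ {x y z}, F.rel 0 x y → F.rel 0 y z → F.rel 0 x z
  connected : WeaklyConnected (F.rel 0)
  leftComm : ∀ {x y z}, F.rel 0 x y → F.rel 1 y z → ∃ u, F.rel 1 x u ∧ F.rel 0 u z
  rightComm : ∀ {x y z}, F.rel 1 x y → F.rel 0 y z → ∃ u, F.rel 0 x u ∧ F.rel 1 u z
  confluent : ∀ {x y z}, F.rel 0 x y → F.rel 1 x z → ∃ u, F.rel 1 y u ∧ F.rel 0 z u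

theorem isLinearCommFrame_of_mem_Fr {L₀ L₁ : Set (Formula Unit)} (h₁ : axiomTrans ∈ L₀)
    (h₂ : axiomWeaklyConnected ∈ L₀) (hF : F ∈ Fr (commutator L₀ L₁)) : IsLinearCommFrame F := by
  have hfus : ∀ φ ∈ L₀, Valid F (rename (fun _ => 0) φ) := fun φ hφ =>
    hF _ (subset_smallestLogic _ (Or.inl (subset_smallestLogic _ (Or.inl ⟨φ, hφ, rfl⟩))))
  have hcomm : ∀ φ ∈ commAxioms, Valid F φ := fun φ hφ =>
    hF _ (subset_smallestLogic _ (Or.inr hφ))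
  exact
    { trans := trans_of_valid (hfus _ h₁)
      connected := weaklyConnected_of_valid (hfus _ h₂)
      leftComm := leftComm_of_valid (hcomm _ (by simp [commAxioms]))
      rightComm := rightComm_of_valid (hcomm _ (by simp [commAxioms]))
      confluent := confluent_of_valid (hcomm _ (by simp [commAxioms])) }

end Correspondence

/-! ### A formula with only infinite linear commutator frames. -/

section InfinityFormula

/-- Along a horizontal line, no point satisfying `s` and `γ` comes before a `γ'`-point that comes
before an `s`-point. -/
def formulaOnce (γ γ' : Formula (Fin 2)) : Formula (Fin 2) :=
  box 0 (imp (conj (var 1) γ) (box 0 (imp γ' (box 0 (neg (var 1))))))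

/-- If an `s`-point of colour `γ` lies ahead, then it lies ahead of a point of colour `γ'` with
no further changes of colour in between. -/
def formulaJump (γ γ' : Formula (Fin 2)) : Formula (Fin 2) :=
  imp (dia 0 (conj (var 1) γ))
    (dia 0 (conj (neg (var 2)) (conj γ' (conj (dia 0 (conj (var 1) γ))
      (box 0 (imp γ (box 0 (imp γ' (box 0 (neg (var 1)))))))))))

/-- A formula forcing infinitely many points in linear commutator frames. The variable `0` colours
the columns, the variable `2` marks the initial column. -/
def formulaInfinity : Formula (Fin 2) :=
  conj (box 0 (imp (var 0) (box 1 (var 0))))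
  (conj (box 0 (imp (neg (var 0)) (box 1 (neg (var 0)))))
  (conj (box 0 (imp (var 2) (box 1 (var 2))))
  (conj (dia 0 (conj (neg (var 2)) (conj (var 0) (box 0 (var 0)))))
  (conj (box 0 (imp (neg (var 2)) (dia 1 (var 1))))
  (conj (box 1 (conj (formulaOnce (var 0) (neg (var 0))) (formulaOnce (neg (var 0)) (var 0))))
    (box 1 (conj (formulaJump (var 0) (neg (var 0))) (formulaJump (neg (var 0)) (var 0)))))))))

/-- There is an `R`-chain starting at `x` along which membership in `C` changes `k` times. -/
def HasAlternation {W : Type} (R : W → W → Prop) (C : Set W) : ℕ → W → Prop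
  | 0, _ => True
  | k + 1, x => ∃ y, R x y ∧ (y ∈ C ↔ x ∉ C) ∧ HasAlternation R C k y

theorem HasAlternation.of_le {W : Type} {R : W → W → Prop} {C : Set W} {k l : ℕ} {x : W}
    (hkl : k ≤ l) (h : HasAlternation R C l x) : HasAlternation R C k x := by
  induction k generalizing l x with
  | zero => trivial
  | succ k ih =>
    obtain ⟨l, rfl⟩ : ∃ m, l = m + 1 := ⟨l - 1, by omega⟩
    obtain ⟨y, hy, hc, ha⟩ := h
    exact ⟨y, hy, hc, ih (by omega) ha⟩

variable {F : Frame (Fin 2)} (hF : IsLinearCommFrame F)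
include hF

/-- Chains move between the rows of `x` and `z` step by step: confluence carries a step from `x`
over to `z`, right commutativity carries one back, and the colour is constant on columns. -/
theorem IsLinearCommFrame.hasAlternation_iff {C : Set F.World} {r x z : F.World}
    (hC : ∀ u v, F.rel 0 r u → F.rel 1 u v → (v ∈ C ↔ u ∈ C)) (hx : F.rel 0 r x)
    (hz : F.rel 1 x z) (k : ℕ) :
    HasAlternation (F.rel 0) C k x ↔ HasAlternation (F.rel 0) C k z := by
  induction k generalizing x z with
  | zero => exact Iff.rfl
  | succ k ih =>
    have hxz := hC x z hx hz
    constructor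
    · rintro ⟨v, hv, hc, ha⟩
      obtain ⟨u, hvu, hzu⟩ := hF.confluent hv hz
      have hrv := hF.trans hx hv
      have := hC v u hrv hvu
      exact ⟨u, hzu, by tauto, (ih hrv hvu).1 ha⟩
    · rintro ⟨u, hu, hc, ha⟩
      obtain ⟨v, hxv, hvu⟩ := hF.rightComm hz hu
      have hrv := hF.trans hx hxv
      have := hC v u hrv hvu
      exact ⟨v, hxv, by tauto, (ih hrv hvu).2 ha⟩

/-- The inductive step inside one row. By linearity and `honce`, `y` precedes `s`, which adds a
colour change. After two changes from `y` one must be beyond `s`, by `hjump`, so no more than one is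
added. -/
theorem IsLinearCommFrame.hasAlternation_jump {C S : Set F.World} {a s y : F.World} {k : ℕ}
    (has : F.rel 0 a s) (hay : F.rel 0 a y) (hys : s ∈ C ↔ y ∉ C) (hsS : s ∈ S)
    (honce : ∀ u, F.rel 0 s u → (u ∈ C ↔ s ∉ C) → ∀ v, F.rel 0 u v → v ∉ S)
    (hyS : ∃ v, F.rel 0 y v ∧ v ∈ S)
    (hjump : ∀ u, F.rel 0 y u → (u ∈ C ↔ s ∈ C) → ∀ v, F.rel 0 u v → (v ∈ C ↔ y ∈ C) →
      ∀ w, F.rel 0 v w → w ∉ S)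
    (h₁ : HasAlternation (F.rel 0) C k s) (h₂ : ¬ HasAlternation (F.rel 0) C (k + 1) s) :
    HasAlternation (F.rel 0) C (k + 1) y ∧ ¬ HasAlternation (F.rel 0) C (k + 2) y := by
  constructor
  · refine ⟨s, ?_, hys, h₁⟩
    rcases hF.connected a s y has hay with rfl | h | h
    · tauto
    · obtain ⟨v, hv, hvS⟩ := hyS
      exact absurd hvS (honce y h (by tauto) v hv)
    · exact h
  · rintro ⟨u, hu, huc, v, hv, hvc, ha⟩
    -- If `v` lies after `s`, the step from `s` to `v` is a colour change followed by `k` more,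
    -- which the rank of `s` excludes.
    refine h₂ ⟨v, ?_, by tauto, ha⟩
    rcases hF.connected a s v has (hF.trans hay (hF.trans hu hv)) with rfl | h | h
    · tauto
    · exact h
    · exact absurd hsS (hjump u hu (by tauto) v hv (by tauto) s h)

theorem IsLinearCommFrame.infinite_of_sat {V : ℕ → Set F.World} {r : F.World}
    (hr : Sat F V r formulaInfinity) : Infinite F.World := by
  simp only [formulaInfinity, formulaOnce, formulaJump, sat_conj, sat_box, sat_imp, sat_dia,
    sat_neg, sat_var] at hr
  obtain ⟨hc₁, hc₂, ht, ⟨x₀, hx₀, hx₀t, hx₀c, hx₀'⟩, hs, honce, hjump⟩ := hr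
  have hC : ∀ u v, F.rel 0 r u → F.rel 1 u v → (v ∈ V 0 ↔ u ∈ V 0) := fun u v hu hv =>
    ⟨fun h => by_contra fun h' => hc₂ u hu h' v hv h, fun h => hc₁ u hu h v hv⟩
  have key : ∀ k, ∃ x, F.rel 0 r x ∧ x ∉ V 2 ∧ HasAlternation (F.rel 0) (V 0) k x ∧
      ¬ HasAlternation (F.rel 0) (V 0) (k + 1) x := by
    intro k
    induction k with
    | zero =>
      refine ⟨x₀, hx₀, hx₀t, trivial, ?_⟩
      rintro ⟨y, hy, hc, -⟩
      exact hc.1 (hx₀' y hy) hx₀c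
    | succ k ih =>
      obtain ⟨x, hx, hxt, h₁, h₂⟩ := ih
      obtain ⟨s, hxs, hsS⟩ := hs x hx hxt
      rw [hF.hasAlternation_iff hC hx hxs] at h₁ h₂
      obtain ⟨a, hra, has⟩ := hF.leftComm hx hxs
      obtain ⟨y, hay, hyt, h₁, h₂⟩ : ∃ y, F.rel 0 a y ∧ y ∉ V 2 ∧
          HasAlternation (F.rel 0) (V 0) (k + 1) y ∧
          ¬ HasAlternation (F.rel 0) (V 0) (k + 2) y := by
        by_cases hsc : s ∈ V 0
        · obtain ⟨y, hay, hyt, hyc, ⟨v, hyv, hvS, -⟩, hy⟩ := (hjump a hra).1 ⟨s, has, hsS, hsc⟩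
          refine ⟨y, hay, hyt, hF.hasAlternation_jump (S := V 1) has hay (by tauto) hsS
            (fun u hu hcu => (honce a hra).1 s has ⟨hsS, hsc⟩ u hu (by tauto)) ⟨v, hyv, hvS⟩
            (fun u hu hcu v hv hcv => hy u hu (by tauto) v hv (by tauto)) h₁ h₂⟩
        · obtain ⟨y, hay, hyt, hyc, ⟨v, hyv, hvS, -⟩, hy⟩ := (hjump a hra).2 ⟨s, has, hsS, hsc⟩
          refine ⟨y, hay, hyt, hF.hasAlternation_jump (S := V 1) has hay (by tauto) hsS
            (fun u hu hcu => (honce a hra).2 s has ⟨hsS, hsc⟩ u hu (by tauto)) ⟨v, hyv, hvS⟩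
            (fun u hu hcu v hv hcv => hy u hu (by tauto) v hv (by tauto)) h₁ h₂⟩
      obtain ⟨x', hx', hxy⟩ := hF.rightComm hra hay
      rw [← hF.hasAlternation_iff hC hx' hxy] at h₁ h₂
      -- The marker `var 2` would spread vertically from `x'` to `y`, so `x'` is again outside the
      -- initial column and the induction can continue.
      exact ⟨x', hx', fun h => hyt (ht x' hx' h y hxy), h₁, h₂⟩
  choose x _ _ hx hx' using key
  -- `x k` has rank exactly `k`, so distinct indices give distinct points.
  refine Infinite.of_injective x fun m n hmn => ?_
  by_contra hne
  rcases Nat.lt_or_gt_of_ne hne with h | h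
  · exact hx' m (hmn ▸ (hx n).of_le h)
  · exact hx' n (hmn ▸ (hx m).of_le h)

end InfinityFormula

/-! ### Infinite descending chains as frames for the linear logics. -/

section DescendingChains

/-- The frame on `ℕ ∪ {∞}` with a given relation. -/
abbrev chainFrame (d : ℕ∞ → ℕ∞ → Prop) : Frame Unit := uframe ℕ∞ d

/-- The reflexive descending chain. -/
def descLe (a b : ℕ∞) : Prop := b ≤ a

/-- The strictly descending chain whose last point is reflexive. -/
def descLt (a b : ℕ∞) : Prop := b < a ∨ a = 0 ∧ b = 0

/-- `f N` is a p-morphism except that points over `⊤` may miss successors `n > N`. A given formula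
does not notice this for large `N`: at each box, one finite counterexample, if any exists, is fixed
beforehand and `N` is taken beyond it. -/
theorem sat_chainFrame_iff {G : Frame Unit} {d : ℕ∞ → ℕ∞ → Prop} (hd : ∀ n : ℕ, d ⊤ n)
    (f : ℕ → G.World → ℕ∞) (forth : ∀ N u v, G.rel () u v → d (f N u) (f N v))
    (back : ∀ N u b, d (f N u) b →
      (∃ n : ℕ, N < n ∧ b = n ∧ f N u = ⊤) ∨ ∃ v, G.rel () u v ∧ f N v = b)
    (V : ℕ → Set ℕ∞) (φ : Formula Unit) :
    ∃ N₀, ∀ N ≥ N₀, ∀ u, Sat G (fun n => f N ⁻¹' V n) u φ ↔ Sat (chainFrame d) V (f N u) φ := by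
  induction φ with
  | var n => exact ⟨0, fun _ _ _ => Iff.rfl⟩
  | bot => exact ⟨0, fun _ _ _ => Iff.rfl⟩
  | imp φ ψ ihφ ihψ =>
    obtain ⟨N₁, h₁⟩ := ihφ
    obtain ⟨N₂, h₂⟩ := ihψ
    exact ⟨max N₁ N₂, fun N hN u => imp_congr (h₁ N (le_trans (le_max_left _ _) hN) u)
      (h₂ N (le_trans (le_max_right _ _) hN) u)⟩
  | box i φ ih =>
    obtain ⟨N₁, h₁⟩ := ih
    obtain ⟨n₀, hn₀⟩ : ∃ n₀ : ℕ, (∃ n : ℕ, ¬ Sat (chainFrame d) V (n : ℕ∞) φ) →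
        ¬ Sat (chainFrame d) V (n₀ : ℕ∞) φ := by
      by_cases h : ∃ n : ℕ, ¬ Sat (chainFrame d) V (n : ℕ∞) φ
      · exact ⟨h.choose, fun _ => h.choose_spec⟩
      · exact ⟨0, fun h' => absurd h' h⟩
    refine ⟨max N₁ n₀, fun N hN u => ⟨fun h b hb => ?_, fun h v hv => ?_⟩⟩
    · have hb' : ∀ v, G.rel () u v → Sat (chainFrame d) V (f N v) φ := fun v hv =>
        (h₁ N (le_trans (le_max_left _ _) hN) v).1 (h v hv)
      rcases back N u b hb with ⟨n, hn, rfl, hu⟩ | ⟨v, hv, rfl⟩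
      · by_contra hc
        have hn₀' := hn₀ ⟨n, hc⟩
        -- The missed counterexample `n` is replaced by `n₀ ≤ N`, which `⊤` sees and `f N` does not
        -- miss.
        rcases back N u n₀ (hu ▸ hd n₀) with ⟨m, hm, hm', -⟩ | ⟨v, hv, hv'⟩
        · have : n₀ = m := by exact_mod_cast hm'
          have := le_trans (le_max_right N₁ n₀) hN
          omega
        · exact hn₀' (hv' ▸ hb' v hv)
      · exact hb' v hv
    · exact (h₁ N (le_trans (le_max_left _ _) hN) v).2 (h _ (forth N u v hv))

theorem chainFrame_mem_Fr {G : Frame Unit} {d : ℕ∞ → ℕ∞ → Prop} (hd : ∀ n : ℕ, d ⊤ n)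
    (f : ℕ → G.World → ℕ∞) (forth : ∀ N u v, G.rel () u v → d (f N u) (f N v))
    (back : ∀ N u b, d (f N u) b →
      (∃ n : ℕ, N < n ∧ b = n ∧ f N u = ⊤) ∨ ∃ v, G.rel () u v ∧ f N v = b)
    (surj : ∀ b, ∃ N₀, ∀ N ≥ N₀, ∃ u, f N u = b) :
    chainFrame d ∈ Fr (Log {G}) := by
  intro φ hφ V b
  obtain ⟨N₁, h₁⟩ := sat_chainFrame_iff hd f forth back V φ
  obtain ⟨N₂, h₂⟩ := surj b
  obtain ⟨u, rfl⟩ := h₂ (max N₁ N₂) (le_max_right _ _)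
  exact (h₁ _ (le_max_left _ _) u).1 (hφ G rfl _ u)

/-- The map from `ω` to the descending chain that sends `0` to the top and the other numbers to
`N, N - 1, …, 0, 0, …`. -/
def natToChain (N k : ℕ) : ℕ∞ := if k = 0 then ⊤ else ((N + 1 - k : ℕ) : ℕ∞)

theorem natToChain_of_le {N n : ℕ} (h : n ≤ N) : natToChain N (N + 1 - n) = n := by
  rw [natToChain, if_neg (by omega)]
  congr 1
  omega

theorem natToChain_surj (b : ℕ∞) : ∃ N₀, ∀ N ≥ N₀, ∃ u, natToChain N u = b := by
  induction b using ENat.recTopCoe with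
  | top => exact ⟨0, fun N _ => ⟨0, by simp [natToChain]⟩⟩
  | coe n => exact ⟨n, fun N hN => ⟨N + 1 - n, natToChain_of_le hN⟩⟩

theorem descLe_mem_Fr_LogOmegaLe : chainFrame descLe ∈ Fr LogOmegaLe := by
  refine chainFrame_mem_Fr (fun _ => le_top) natToChain ?_ ?_ natToChain_surj
  · intro N (u : ℕ) (v : ℕ) (huv : u ≤ v)
    simp only [descLe, natToChain]
    split_ifs with h₁ h₂
    · exact le_rfl
    · omega
    · exact le_top
    · exact_mod_cast (by omega : N + 1 - v ≤ N + 1 - u)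
  · intro N (u : ℕ) b hb
    change _ ∨ ∃ v : ℕ, u ≤ v ∧ _
    simp only [descLe] at hb
    induction b using ENat.recTopCoe with
    | top =>
      refine Or.inr ⟨u, le_rfl, top_le_iff.1 hb⟩
    | coe n =>
      rcases le_or_gt n N with hn | hn
      · refine Or.inr ?_
        by_cases hu : u = 0
        · exact ⟨N + 1 - n, by omega, natToChain_of_le hn⟩
        · rw [natToChain, if_neg hu] at hb
          have hb : n ≤ N + 1 - u := by exact_mod_cast hb
          by_cases h0 : n = 0
          · refine ⟨max u (N + 1), le_max_left _ _, ?_⟩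
            rw [natToChain, if_neg (by omega)]
            congr 1
            omega
          · exact ⟨N + 1 - n, by omega, natToChain_of_le hn⟩
      · refine Or.inl ⟨n, hn, rfl, ?_⟩
        by_contra hu
        have hu : u ≠ 0 := fun h => hu (by simp [natToChain, h])
        rw [natToChain, if_neg hu] at hb
        have hb : n ≤ N + 1 - u := by exact_mod_cast hb
        omega

/-- The bottom has to be reflexive because infinitely many numbers are sent to `0`. All other values
are taken at most once, hence are irreflexive. -/
theorem descLt_mem_Fr_LogOmegaLt : chainFrame descLt ∈ Fr LogOmegaLt := by
  refine chainFrame_mem_Fr (fun n => Or.inl (ENat.natCast_lt_top n)) natToChain ?_ ?_ natToChain_surj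
  · intro N (u : ℕ) (v : ℕ) (huv : u < v)
    simp only [descLt, natToChain]
    rw [if_neg (by omega : ¬ v = 0)]
    split_ifs with h₁
    · exact Or.inl (ENat.natCast_lt_top _)
    · norm_cast
      omega
  · intro N (u : ℕ) b hb
    change _ ∨ ∃ v : ℕ, u < v ∧ _
    simp only [descLt] at hb
    induction b using ENat.recTopCoe with
    | top => simp at hb
    | coe n =>
      rcases le_or_gt n N with hn | hn
      · refine Or.inr ?_
        by_cases hu : u = 0
        · exact ⟨N + 1 - n, by omega, natToChain_of_le hn⟩
        · rw [natToChain, if_neg hu] at hb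
          norm_cast at hb
          by_cases h0 : n = 0
          · refine ⟨u + N + 1, by omega, ?_⟩
            rw [natToChain, if_neg (by omega)]
            congr 1
            omega
          · exact ⟨N + 1 - n, by omega, natToChain_of_le hn⟩
      · refine Or.inl ⟨n, hn, rfl, ?_⟩
        by_contra hu
        have hu : u ≠ 0 := fun h => hu (by simp [natToChain, h])
        rw [natToChain, if_neg hu] at hb
        norm_cast at hb
        omega

/-- The map from `ℚ` to the descending chain that sends the negative numbers to the top and is
`N - ⌊q⌋` on the other ones. -/
def ratToChain (N : ℕ) (q : ℚ) : ℕ∞ := if q < 0 then ⊤ else ((N - ⌊q⌋₊ : ℕ) : ℕ∞)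

theorem descLe_mem_Fr_LogRatLt : chainFrame descLe ∈ Fr LogRatLt := by
  have hnat : ∀ {N n : ℕ}, n ≤ N → ∀ q : ℚ, 0 ≤ q → ⌊q⌋₊ = N - n → ratToChain N q = n := by
    intro N n hn q hq h
    rw [ratToChain, if_neg (not_lt.2 hq), h]
    congr 1
    omega
  refine chainFrame_mem_Fr (fun _ => le_top) ratToChain ?_ ?_ ?_
  · intro N (u : ℚ) (v : ℚ) (huv : u < v)
    simp only [descLe, ratToChain]
    split_ifs with h₁ h₂
    · exact le_rfl
    · exact absurd (huv.trans h₁) h₂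
    · exact le_top
    · have := Nat.floor_le_floor huv.le
      exact_mod_cast (by omega : N - ⌊v⌋₊ ≤ N - ⌊u⌋₊)
  · intro N (u : ℚ) b hb
    change _ ∨ ∃ v : ℚ, u < v ∧ _
    simp only [descLe] at hb
    by_cases hu : u < 0
    · induction b using ENat.recTopCoe with
      | top =>
        obtain ⟨v, huv, hv⟩ := exists_between hu
        exact Or.inr ⟨v, huv, by simp [ratToChain, hv]⟩
      | coe n =>
        rcases le_or_gt n N with hn | hn
        · exact Or.inr ⟨((N - n : ℕ) : ℚ), hu.trans_le (Nat.cast_nonneg _),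
            hnat hn _ (Nat.cast_nonneg _) (Nat.floor_natCast _)⟩
        · exact Or.inl ⟨n, hn, rfl, by simp [ratToChain, hu]⟩
    · rw [ratToChain, if_neg hu] at hb
      have hu := not_lt.1 hu
      induction b using ENat.recTopCoe with
      | top => simp at hb
      | coe n =>
        have hb : n ≤ N - ⌊u⌋₊ := by exact_mod_cast hb
        refine Or.inr ?_
        rcases le_or_gt ⌊u⌋₊ (N - n) with hle | hlt
        · have h₁ : u < ((N - n : ℕ) : ℚ) + 1 :=
            (Nat.lt_floor_add_one u).trans_le (by gcongr)
          -- Density gives a point beyond `u` inside the unit interval sent to `n`, even if `u` is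
          -- already in it; hence the reflexive chain.
          obtain ⟨v, hv₁, hv₂⟩ := exists_between (max_lt h₁ (lt_add_one (((N - n : ℕ) : ℚ))))
          have hv₃ := (le_max_left _ _).trans_lt hv₁
          have hv₄ := (le_max_right _ _).trans_lt hv₁
          exact ⟨v, hv₃, hnat (by omega) v (hu.trans hv₃.le)
            ((Nat.floor_eq_iff (hu.trans hv₃.le)).2 ⟨hv₄.le, hv₂⟩)⟩
        · have hn : n = 0 := by omega
          subst hn
          refine ⟨u + 1, lt_add_one u, ?_⟩
          rw [ratToChain, if_neg (not_lt.2 (by linarith)), Nat.floor_add_one hu]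
          congr 1
          omega
  · intro b
    induction b using ENat.recTopCoe with
    | top => exact ⟨0, fun N _ => ⟨(-1 : ℚ), by simp [ratToChain]⟩⟩
    | coe n => exact ⟨n, fun N hN => ⟨((N - n : ℕ) : ℚ),
        hnat hN _ (Nat.cast_nonneg _) (Nat.floor_natCast _)⟩⟩

theorem weaklyConnected_descLe : WeaklyConnected descLe := fun _ y z _ _ =>
  Or.inr (le_total z y)

theorem descLe_mem_Fr_LogS43 : chainFrame descLe ∈ Fr LogS43 :=
  mem_Fr_Log ⟨fun x => le_refl (α := ℕ∞) x, fun _ _ _ h₁ h₂ => le_trans (α := ℕ∞) h₂ h₁,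
    weaklyConnected_descLe⟩

/-- A point of the product of a descending chain with a frame on `ℕ`. -/
def chainPoint (d : ℕ∞ → ℕ∞ → Prop) (e : ℕ → ℕ → Prop) (a : ℕ∞) (m : ℕ) :
    (prodFrame (chainFrame d) (uframe ℕ e)).World := (a, m)

/-- The valuation satisfying `formulaInfinity` in products of descending chains with `ℕ`. -/
def chainValuation (d : ℕ∞ → ℕ∞ → Prop) (e : ℕ → ℕ → Prop) (n : ℕ) :
    Set (prodFrame (chainFrame d) (uframe ℕ e)).World :=
  if n = 0 then {x | ∃ k : ℕ, x.1 = (k : ℕ∞) ∧ Even k}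
  else if n = 1 then {x | ∃ k : ℕ, x.1 = (k : ℕ∞) ∧ x.2 = k + 1}
  else {x | x.1 = (⊤ : ℕ∞)}

/-! ### Satisfying the infinity formula in a product. -/

section Evaluation

variable {d : ℕ∞ → ℕ∞ → Prop} {e : ℕ → ℕ → Prop} {a : ℕ∞} {m : ℕ}
  {V : ℕ → Set (prodFrame (chainFrame d) (uframe ℕ e)).World} {φ : Formula (Fin 2)}

theorem sat_chainPoint_box_zero : Sat _ V (chainPoint d e a m) (box 0 φ) ↔
    ∀ b, d a b → Sat _ V (chainPoint d e b m) φ := by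
  refine ⟨fun h b hb => h (b, m) ⟨hb, rfl⟩, ?_⟩
  rintro h ⟨b, k⟩ ⟨hb, hk⟩
  obtain rfl : m = k := hk
  exact h b hb

theorem sat_chainPoint_box_one : Sat _ V (chainPoint d e a m) (box 1 φ) ↔
    ∀ k, e m k → Sat _ V (chainPoint d e a k) φ := by
  refine ⟨fun h k hk => h (a, k) ⟨hk, rfl⟩, ?_⟩
  rintro h ⟨b, k⟩ ⟨hk, hb⟩
  obtain rfl : a = b := hb
  exact h k hk

theorem sat_chainPoint_dia_zero : Sat _ V (chainPoint d e a m) (dia 0 φ) ↔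
    ∃ b, d a b ∧ Sat _ V (chainPoint d e b m) φ := by
  rw [dia, sat_neg, sat_chainPoint_box_zero]
  simp

theorem sat_chainPoint_dia_one : Sat _ V (chainPoint d e a m) (dia 1 φ) ↔
    ∃ k, e m k ∧ Sat _ V (chainPoint d e a k) φ := by
  rw [dia, sat_neg, sat_chainPoint_box_one]
  simp

theorem sat_chainPoint_var_zero : Sat _ (chainValuation d e) (chainPoint d e a m) (var 0) ↔
    ∃ k : ℕ, a = k ∧ Even k := Iff.rfl

theorem sat_chainPoint_var_one : Sat _ (chainValuation d e) (chainPoint d e a m) (var 1) ↔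
    ∃ k : ℕ, a = k ∧ m = k + 1 := Iff.rfl

theorem sat_chainPoint_var_two : Sat _ (chainValuation d e) (chainPoint d e a m) (var 2) ↔
    a = ⊤ := Iff.rfl

/-- A row has at most one `s`-point, so anything between two `s`-points of it is that point and
cannot have the other colour. -/
theorem sat_formulaOnce (h : ∀ a b, d a b → b ≤ a) {γ γ' : Formula (Fin 2)}
    (hγ : ∀ b, Sat _ (chainValuation d e) (chainPoint d e b m) γ →
      ¬ Sat _ (chainValuation d e) (chainPoint d e b m) γ') :
    Sat _ (chainValuation d e) (chainPoint d e a m) (formulaOnce γ γ') := by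
  simp only [formulaOnce, sat_chainPoint_box_zero, sat_imp, sat_conj, sat_neg,
    sat_chainPoint_var_one]
  rintro _ - ⟨⟨k, rfl, rfl⟩, hk⟩ b hb hbγ c hc ⟨l, rfl, hl⟩
  obtain rfl : k = l := by omega
  obtain rfl : b = k := le_antisymm (h _ _ hb) (h _ _ hc)
  exact hγ _ hk hbγ

theorem sat_formulaJump (h₁ : ∀ a b, b < a → d a b) (h₂ : ∀ a b, d a b → b ≤ a)
    {γ γ' : Formula (Fin 2)}
    (hγ : ∀ b, Sat _ (chainValuation d e) (chainPoint d e b m) γ →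
      ¬ Sat _ (chainValuation d e) (chainPoint d e b m) γ')
    (hs : ∀ k : ℕ, Sat _ (chainValuation d e) (chainPoint d e k m) γ →
      Sat _ (chainValuation d e) (chainPoint d e (k + 1 : ℕ) m) γ') :
    Sat _ (chainValuation d e) (chainPoint d e ⊤ m) (formulaJump γ γ') := by
  simp only [formulaJump, sat_chainPoint_box_zero, sat_chainPoint_dia_zero, sat_imp, sat_conj,
    sat_neg, sat_chainPoint_var_one, sat_chainPoint_var_two]
  rintro ⟨_, -, ⟨k, rfl, rfl⟩, hk⟩
  -- The column just before `k` works: no column lies strictly between `k + 1` and `k`.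
  refine ⟨(k + 1 : ℕ), h₁ _ _ (ENat.natCast_lt_top _), ENat.natCast_ne_top _, hs k hk,
    ⟨k, h₁ _ _ (by exact_mod_cast k.lt_succ_self), ⟨k, rfl, rfl⟩, hk⟩, ?_⟩
  rintro b hb hbγ c hc hcγ' e' he' ⟨l, rfl, hl⟩
  obtain rfl : k = l := by omega
  have hbk : b ≠ (k + 1 : ℕ) := by
    rintro rfl
    exact hγ _ hbγ (hs k hk)
  have hb' : b ≤ k := by
    have := lt_of_le_of_ne (h₂ _ _ hb) hbk
    exact Order.le_of_lt_add_one (by exact_mod_cast this)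
  obtain rfl : c = k := le_antisymm ((h₂ _ _ hc).trans hb') (h₂ _ _ he')
  exact hγ _ hk hcγ'

/-- Column `k` has rank `k` and its `s`-point in row `k + 1`; row `0` is the root's. Column `⊤` has
no `s`-point and may see itself, which is why `var 2` exempts it. -/
theorem sat_formulaInfinity (h₁ : ∀ a b, b < a → d a b) (h₂ : ∀ a b, d a b → b ≤ a)
    (he : ∀ n, e 0 (n + 1)) :
    Sat _ (chainValuation d e) (chainPoint d e ⊤ 0) formulaInfinity := by
  have hγ : ∀ b m, Sat _ (chainValuation d e) (chainPoint d e b m) (var 0) →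
      ¬ Sat _ (chainValuation d e) (chainPoint d e b m) (neg (var 0)) := fun _ _ h h' => h' h
  rw [formulaInfinity]
  simp only [sat_conj]
  refine ⟨?_, ?_, ?_, ?_, ?_, ?_, ?_⟩
  · exact sat_chainPoint_box_zero.2 fun _ _ h => sat_chainPoint_box_one.2 fun _ _ => h
  · exact sat_chainPoint_box_zero.2 fun _ _ h => sat_chainPoint_box_one.2 fun _ _ => h
  · exact sat_chainPoint_box_zero.2 fun _ _ h => sat_chainPoint_box_one.2 fun _ _ => h
  · simp only [sat_chainPoint_box_zero, sat_chainPoint_dia_zero, sat_conj, sat_neg,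
      sat_chainPoint_var_zero, sat_chainPoint_var_two]
    refine ⟨(0 : ℕ), h₁ _ _ (ENat.natCast_lt_top 0), ENat.natCast_ne_top 0, ⟨0, rfl, Even.zero⟩,
      fun b hb => ⟨0, le_antisymm (h₂ _ _ hb) (by simp), Even.zero⟩⟩
  · simp only [sat_chainPoint_box_zero, sat_chainPoint_dia_one, sat_imp, sat_neg,
      sat_chainPoint_var_one, sat_chainPoint_var_two]
    intro b _ hb
    obtain ⟨n, rfl⟩ := ENat.ne_top_iff_exists.1 hb
    exact ⟨n + 1, he n, n, rfl, rfl⟩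
  · refine sat_chainPoint_box_one.2 fun m _ => sat_conj.2 ⟨?_, ?_⟩
    · exact sat_formulaOnce h₂ fun b => hγ b m
    · exact sat_formulaOnce h₂ fun b h h' => hγ b m h' h
  · refine sat_chainPoint_box_one.2 fun m _ => sat_conj.2 ⟨?_, ?_⟩
    · refine sat_formulaJump h₁ h₂ (fun b => hγ b m) fun k => ?_
      rintro ⟨l, hl, hl'⟩ ⟨l', hl₂, hl₂'⟩
      have hl : k = l := Nat.cast_injective (R := ℕ∞) hl
      have hl₂ : k + 1 = l' := Nat.cast_injective (R := ℕ∞) hl₂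
      subst hl hl₂
      exact (Nat.even_add_one.1 hl₂') hl'
    · refine sat_formulaJump h₁ h₂ (fun b h h' => hγ b m h' h) fun k hk => ?_
      exact ⟨k + 1, rfl, Nat.even_add_one.2 fun h => hk ⟨k, rfl, h⟩⟩

end Evaluation

end DescendingChains

/-! ### Product frames validate the commutator. -/

section Products

variable {F₀ F₁ : Frame Unit} {V : ℕ → Set (prodFrame F₀ F₁).World}

theorem sat_rename_zero (a : F₀.World) (b : F₁.World) (φ : Formula Unit) :
    Sat (prodFrame F₀ F₁) V (a, b) (rename (fun _ => 0) φ) ↔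
      Sat F₀ (fun n => {u | (u, b) ∈ V n}) a φ := by
  induction φ generalizing a with
  | var n => exact Iff.rfl
  | bot => exact Iff.rfl
  | imp φ ψ ihφ ihψ => exact imp_congr (ihφ a) (ihψ a)
  | box i φ ih =>
    refine ⟨fun h u hu => (ih u).1 (h (u, b) ⟨hu, rfl⟩), fun h => ?_⟩
    rintro ⟨u, v⟩ ⟨hu, hv⟩
    obtain rfl : b = v := hv
    exact (ih u).2 (h u hu)

theorem sat_rename_one (a : F₀.World) (b : F₁.World) (φ : Formula Unit) :
    Sat (prodFrame F₀ F₁) V (a, b) (rename (fun _ => 1) φ) ↔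
      Sat F₁ (fun n => {u | (a, u) ∈ V n}) b φ := by
  induction φ generalizing b with
  | var n => exact Iff.rfl
  | bot => exact Iff.rfl
  | imp φ ψ ihφ ihψ => exact imp_congr (ihφ b) (ihψ b)
  | box i φ ih =>
    refine ⟨fun h u hu => (ih u).1 (h (a, u) ⟨hu, rfl⟩), fun h => ?_⟩
    rintro ⟨v, u⟩ ⟨hu, hv⟩
    obtain rfl : a = v := hv
    exact (ih u).2 (h u hu)

theorem valid_prodFrame_of_mem_commAxioms {φ : Formula (Fin 2)} (hφ : φ ∈ commAxioms) :
    Valid (prodFrame F₀ F₁) φ := by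
  intro V
  rintro ⟨a, b⟩
  simp only [commAxioms, Set.mem_insert_iff, Set.mem_singleton_iff] at hφ
  rcases hφ with rfl | rfl | rfl
  · rintro h ⟨u, _⟩ ⟨hu, rfl⟩ ⟨_, v⟩ ⟨hv, rfl⟩
    exact h (a, v) ⟨hv, rfl⟩ (u, v) ⟨hu, rfl⟩
  · rintro h ⟨_, v⟩ ⟨hv, rfl⟩ ⟨u, _⟩ ⟨hu, rfl⟩
    exact h (u, b) ⟨hu, rfl⟩ (u, v) ⟨hv, rfl⟩
  · intro h
    obtain ⟨⟨u, _⟩, ⟨hu, rfl⟩, h⟩ := sat_dia.1 h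
    rintro ⟨_, v⟩ ⟨hv, rfl⟩
    exact sat_dia.2 ⟨(u, v), ⟨hu, rfl⟩, h (u, v) ⟨hv, rfl⟩⟩

theorem commutator_subset_prodLogic (L₀ L₁ : Set (Formula Unit)) :
    commutator L₀ L₁ ⊆ prodLogic L₀ L₁ := by
  refine fun φ hφ => hφ _ (isNormalLogic_Log _) (Set.union_subset (fun ψ hψ =>
    hψ _ (isNormalLogic_Log _) (Set.union_subset ?_ ?_)) ?_)
  · rintro _ ⟨ψ, hψ, rfl⟩ _ ⟨F₀, h₀, F₁, h₁, rfl⟩ V ⟨a, b⟩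
    exact (sat_rename_zero a b ψ).2 (h₀ ψ hψ _ a)
  · rintro _ ⟨ψ, hψ, rfl⟩ _ ⟨F₀, h₀, F₁, h₁, rfl⟩ V ⟨a, b⟩
    exact (sat_rename_one a b ψ).2 (h₁ ψ hψ _ b)
  · rintro ψ hψ _ ⟨F₀, h₀, F₁, h₁, rfl⟩
    exact valid_prodFrame_of_mem_commAxioms hψ

end Products

/-! ### Failure of the fmp, and the frames for each listed logic. -/

theorem not_hasFMP {L₀ L₁ : Set (Formula Unit)} {d : ℕ∞ → ℕ∞ → Prop} {e : ℕ → ℕ → Prop}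
    (hax : axiomTrans ∈ L₀ ∧ axiomWeaklyConnected ∈ L₀) (h₁ : ∀ a b, b < a → d a b)
    (h₂ : ∀ a b, d a b → b ≤ a) (he : ∀ n, e 0 (n + 1)) (hd : chainFrame d ∈ Fr L₀)
    (he' : uframe ℕ e ∈ Fr L₁) {L : Set (Formula (Fin 2))} (hL : IsNormalLogic L)
    (hcL : commutator L₀ L₁ ⊆ L) (hLp : L ⊆ prodLogic L₀ L₁) : ¬ HasFMP L := by
  intro hfmp
  have hmem : neg formulaInfinity ∉ L := fun h =>
    hLp h _ ⟨_, hd, _, he', rfl⟩ _ _ (sat_formulaInfinity (d := d) h₁ h₂ he)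
  obtain ⟨G, hG, hfin, hval⟩ := hfmp.exists_finite_frame hL hmem
  have hlin := isLinearCommFrame_of_mem_Fr hax.1 hax.2 (fun φ hφ => hG φ (hcL hφ))
  refine hval fun V w hw => ?_
  have := hlin.infinite_of_sat hw
  exact not_finite G.World

theorem exists_chain_of_mem {L₀ : Set (Formula Unit)}
    (h : L₀ ∈ ({LogOmegaLt, LogOmegaLe, LogS43, LogRatLt} : Set (Set (Formula Unit)))) :
    (axiomTrans ∈ L₀ ∧ axiomWeaklyConnected ∈ L₀) ∧ ∃ d : ℕ∞ → ℕ∞ → Prop,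
      (∀ a b, b < a → d a b) ∧ (∀ a b, d a b → b ≤ a) ∧ chainFrame d ∈ Fr L₀ := by
  have hLe : (∀ a b, b < a → descLe a b) ∧ (∀ a b, descLe a b → b ≤ a) :=
    ⟨fun _ _ h => h.le, fun _ _ h => h⟩
  simp only [Set.mem_insert_iff, Set.mem_singleton_iff] at h
  rcases h with rfl | rfl | rfl | rfl
  · refine ⟨axioms_mem_Log ?_, descLt, fun _ _ h => Or.inl h, ?_, descLt_mem_Fr_LogOmegaLt⟩
    · rintro _ rfl
      exact ⟨fun _ _ _ => lt_trans (α := ℕ), fun _ y z _ _ => by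
        rcases lt_trichotomy (α := ℕ) y z with h | h | h
        exacts [Or.inr (Or.inl h), Or.inl h, Or.inr (Or.inr h)]⟩
    · rintro a b (h | ⟨rfl, rfl⟩)
      exacts [h.le, le_rfl]
  · refine ⟨axioms_mem_Log ?_, descLe, hLe.1, hLe.2, descLe_mem_Fr_LogOmegaLe⟩
    rintro _ rfl
    exact ⟨fun _ _ _ => le_trans (α := ℕ), fun _ y z _ _ => Or.inr (le_total (α := ℕ) y z)⟩
  · exact ⟨axioms_mem_Log fun F hF => hF.2, descLe, hLe.1, hLe.2, descLe_mem_Fr_LogS43⟩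
  · refine ⟨axioms_mem_Log ?_, descLe, hLe.1, hLe.2, descLe_mem_Fr_LogRatLt⟩
    rintro _ rfl
    exact ⟨fun _ _ _ => lt_trans (α := ℚ), fun _ y z _ _ => by
      rcases lt_trichotomy (α := ℚ) y z with h | h | h
      exacts [Or.inr (Or.inl h), Or.inl h, Or.inr (Or.inr h)]⟩

theorem exists_fan_of_mem {L₁ : Set (Formula Unit)}
    (h : L₁ ∈ ({LogK, LogS5, LogDiff} : Set (Set (Formula Unit)))) :
    ∃ e : ℕ → ℕ → Prop, (∀ n, e 0 (n + 1)) ∧ uframe ℕ e ∈ Fr L₁ := by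
  simp only [Set.mem_insert_iff, Set.mem_singleton_iff] at h
  rcases h with rfl | rfl | rfl
  · exact ⟨fun _ _ => True, fun _ => trivial, mem_Fr_Log trivial⟩
  · exact ⟨fun _ _ => True, fun _ => trivial,
      mem_Fr_Log ⟨fun _ => trivial, fun _ => trivial, fun _ _ => trivial⟩⟩
  · exact ⟨fun m n => m ≠ n, fun n => (Nat.succ_ne_zero n).symm, mem_Fr_Log fun _ _ => Iff.rfl⟩

end ModalLogic

theorem mainTheorem5 :
    (∀ L₀ ∈ ({ModalLogic.LogOmegaLt, ModalLogic.LogOmegaLe, ModalLogic.LogS43,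
        ModalLogic.LogRatLt} : Set (Set (ModalLogic.Formula Unit))),
      ∀ L₁ ∈ ({ModalLogic.LogK, ModalLogic.LogS5, ModalLogic.LogDiff} :
        Set (Set (ModalLogic.Formula Unit))),
      ∀ L : Set (ModalLogic.Formula (Fin 2)), ModalLogic.IsNormalLogic L →
        ModalLogic.commutator L₀ L₁ ⊆ L → L ⊆ ModalLogic.prodLogic L₀ L₁ →
        ¬ ModalLogic.HasFMP L) ∧
    ¬ ModalLogic.HasFMP (ModalLogic.prodLogic ModalLogic.LogS43 ModalLogic.LogS5) := by
  have main : ∀ L₀ ∈ ({ModalLogic.LogOmegaLt, ModalLogic.LogOmegaLe, ModalLogic.LogS43,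
        ModalLogic.LogRatLt} : Set (Set (ModalLogic.Formula Unit))),
      ∀ L₁ ∈ ({ModalLogic.LogK, ModalLogic.LogS5, ModalLogic.LogDiff} :
        Set (Set (ModalLogic.Formula Unit))),
      ∀ L : Set (ModalLogic.Formula (Fin 2)), ModalLogic.IsNormalLogic L →
        ModalLogic.commutator L₀ L₁ ⊆ L → L ⊆ ModalLogic.prodLogic L₀ L₁ →
        ¬ ModalLogic.HasFMP L := by
    intro L₀ h₀ L₁ h₁ L hL hcL hLp
    obtain ⟨hax, d, hd₁, hd₂, hd⟩ := ModalLogic.exists_chain_of_mem h₀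
    obtain ⟨e, he, he'⟩ := ModalLogic.exists_fan_of_mem h₁
    exact ModalLogic.not_hasFMP hax hd₁ hd₂ he hd he' hL hcL hLp
  exact ⟨main, main _ (by simp) _ (by simp) _ (ModalLogic.isNormalLogic_Log _)
    (ModalLogic.commutator_subset_prodLogic _ _) subset_rfl⟩
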